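/- For a simple graph $G$ and $\alpha\in[0,1]$ let $A_\alpha(G)=\alpha D(G)+(1-\alpha)A(G)$, where $D(G)$ is the diagonal matrix of vertex degrees and $A(G)$ the adjacency matrix; put $\beta=1-\alpha$. Let $B_k$ be a generalized Bethe tree on $k\ge 1$ levels, that is, a finite rooted tree in which vertices at the same level have the same degree, the level of a vertex being one more than its distance from the root, and whose largest level is $k$. For $1\le j\le k$ let $n_j$ and $d_j$ be the number and the degree of the vertices of $B_k$ at level $k-j+1$ (so $n_k=1$, $d_k$ is the degree of the root, and $d_1=1$ if $k\ge 2$). Let $r\ge 3$, let $C_r$ be the cycle on $r$ vertices $v_1,\dots,v_r$, and let $C_r\{B_k\}$ be the graph obtained from $C_r$ and $r$ copies of $B_k$ by identifying the root of the $i$-th copy with $v_i$ for each $i$. Let $T_k$ be the $k\times k$ symmetric tridiagonal matrix with diagonal entries $\alpha d_1,\alpha d_2,\dots,\alpha d_k$ and codiagonal entries $\beta\sqrt{d_2-1},\dots,\beta\sqrt{d_{k-1}-1},\beta\sqrt{d_k}$, and for $1\le j\le k-1$ let $T_j$ be its $j\times j$ leading principal submatrix. For $1\le i\le r$ let $$\rho_i(\alpha)=2\alpha+2(1-\alpha)\cos\frac{2\pi(i-1)}{r},$$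 and let $S_i$ be the matrix obtained from $T_k$ by replacing its last diagonal entry by $\alpha d_k+\rho_i(\alpha)$. Then: (1) $$\mathrm{Spec}(A_\alpha(C_r\{B_k\}))=\Big(\bigcup_{\substack{1\le j\le k-1\\ n_j>n_{j+1}}}\mathrm{Spec}(T_j)\Big)\cup\Big(\bigcup_{i=1}^r\mathrm{Spec}(S_i)\Big).$$ (2) For $1\le j\le k-1$, each eigenvalue of $T_j$ contributes multiplicity $r(n_j-n_{j+1})$ (that is, nothing if $n_j=n_{j+1}$) to $A_\alpha(C_r\{B_k\})$, and for $1\le i\le r$ each eigenvalue of $S_i$ contributes multiplicity $1$, the contributions of equal eigenvalues being added together: if $m_M(\mu)$ denotes the algebraic multiplicity of $\mu\in\mathbb R$ as an eigenvalue of a matrix $M$ ($0$ if $\mu$ is not an eigenvalue), then for all $\mu\in\mathbb R$ $$m_{A_\alpha(C_r\{B_k\})}(\mu)=\sum_{j=1}^{k-1}r(n_j-n_{j+1})\,m_{T_j}(\mu)+\sum_{i=1}^r m_{S_i}(\mu).$$ Moreover, if $\alpha<1$, every eigenvalue of each of the matrices $T_1,\dots,T_{k-1},S_1,\dots,S_r$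 is simple as an eigenvalue of that matrix, so that the multiplicities $m_{T_j}(\mu)$ and $m_{S_i}(\mu)$ are all $0$ or $1$. (3) $\rho_1(\alpha)=2$, so that the last diagonal entry of $S_1$ is $\alpha d_k+2$, and the largest eigenvalue of $S_1$ is the spectral radius of $A_\alpha(C_r\{B_k\})$. -/

import Mathlib

/-- The matrix `A_α(G) = α D(G) + (1 - α) A(G)`. -/
noncomputable def alphaMatrix {V : Type*} [Fintype V] [DecidableEq V] (α : ℝ)
    (G : SimpleGraph V) [DecidableRel G.Adj] : Matrix V V ℝ :=
  α • G.degMatrix ℝ + (1 - α) • G.adjMatrix ℝ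

/-- The graph `R{H}`, obtained from `R` and one copy of the rooted graph `(H, root)` for each
vertex `i` of `R` by identifying the root of the `i`-th copy with `i`. The vertex `(i, u)` is the
vertex `u` of the `i`-th copy, so `(i, root)` is also the vertex `i` of `R`. -/
def rootedCopies {ι V : Type*} (R : SimpleGraph ι) (H : SimpleGraph V) (root : V) :
    SimpleGraph (ι × V) where
  Adj x y := (x.1 = y.1 ∧ H.Adj x.2 y.2) ∨ (R.Adj x.1 y.1 ∧ x.2 = root ∧ y.2 = root)
  symm := ⟨by
    rintro x y (⟨h, h'⟩ | ⟨h, h', h''⟩)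
    · exact Or.inl ⟨h.symm, h'.symm⟩
    · exact Or.inr ⟨h.symm, h'', h'⟩⟩
  loopless := ⟨by
    rintro x (⟨_, h⟩ | ⟨h, _⟩)
    · exact H.irrefl h
    · exact R.irrefl h⟩

instance {ι V : Type*} [DecidableEq ι] [DecidableEq V] (R : SimpleGraph ι) (H : SimpleGraph V)
    (root : V) [DecidableRel R.Adj] [DecidableRel H.Adj] :
    DecidableRel (rootedCopies R H root).Adj := fun x y =>
  inferInstanceAs (Decidable
    ((x.1 = y.1 ∧ H.Adj x.2 y.2) ∨ (R.Adj x.1 y.1 ∧ x.2 = root ∧ y.2 = root)))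

/-- The level of a vertex of a rooted graph: one more than its distance from the root. -/
noncomputable def vertexLevel {V : Type*} (B : SimpleGraph V) (root v : V) : ℕ :=
  B.dist root v + 1

/-- `B`, rooted at `root`, is a generalized Bethe tree on `k` levels: a rooted tree in which
vertices at the same level have the same degree, and whose largest level is `k`. -/
structure IsGeneralizedBetheTree {V : Type*} [Fintype V] (B : SimpleGraph V)
    [DecidableRel B.Adj] (root : V) (k : ℕ) : Prop where
  isTree : B.IsTree
  degree_eq : ∀ u v : V, vertexLevel B root u = vertexLevel B root v → B.degree u = B.degree v
  level_le : ∀ v : V, vertexLevel B root v ≤ k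
  exists_level : ∃ v : V, vertexLevel B root v = k

/-- The vertices at level `k - j + 1` (used for `1 ≤ j ≤ k`), that is, the vertices at level `j`
counted from the bottom. -/
noncomputable def levelFromBottom {V : Type*} [Fintype V] (B : SimpleGraph V) (root : V)
    (k j : ℕ) : Finset V :=
  Finset.univ.filter fun v => vertexLevel B root v = k - j + 1

/-- `n_j`: the number of vertices at level `k - j + 1`. -/
noncomputable def levelCount {V : Type*} [Fintype V] (B : SimpleGraph V) (root : V)
    (k j : ℕ) : ℕ :=
  (levelFromBottom B root k j).card

/-- `d_j`: the degree of the vertices at level `k - j + 1`. In a generalized Bethe tree these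
degrees all agree, so that their maximum is the common value. -/
noncomputable def levelDegree {V : Type*} [Fintype V] (B : SimpleGraph V) [DecidableRel B.Adj]
    (root : V) (k j : ℕ) : ℕ :=
  (levelFromBottom B root k j).sup fun v => B.degree v

theorem IsGeneralizedBetheTree.degree_eq_levelDegree {V : Type*} [Fintype V] {B : SimpleGraph V}
    [DecidableRel B.Adj] {root : V} {k : ℕ} (hB : IsGeneralizedBetheTree B root k) {j : ℕ} {v : V}
    (hv : v ∈ levelFromBottom B root k j) : B.degree v = levelDegree B root k j := by
  apply le_antisymm
  · exact Finset.le_sup (f := fun v => B.degree v) hv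
  · apply Finset.sup_le
    intro u hu
    simp only [levelFromBottom, Finset.mem_filter, Finset.mem_univ, true_and] at hu hv
    exact (hB.degree_eq u v (hu.trans hv.symm)).le

/-- The entry in row `s` and column `t` (both counted from `1`) of the symmetric tridiagonal
`k × k` matrix with diagonal `α d_1, α d_2, …, α d_k` and codiagonal
`β √(d_2 - 1), …, β √(d_{k-1} - 1), β √d_k`, where `β = 1 - α`.
(If `k ≥ 2`, then `d_1 = 1`, and the first diagonal entry is `α`.) -/
noncomputable def betheEntry (α : ℝ) (d : ℕ → ℕ) (k s t : ℕ) : ℝ :=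
  if s = t then α * d s
  else if s + 1 = t ∨ t + 1 = s then
    (1 - α) * (if max s t = k then √(d k : ℝ) else √((d (max s t) : ℝ) - 1))
  else 0

/-- `T_j`: the `j × j` leading principal submatrix (`j ≤ k`) of the tridiagonal matrix `T_k`. -/
noncomputable def matT (α : ℝ) (d : ℕ → ℕ) (k j : ℕ) : Matrix (Fin j) (Fin j) ℝ :=
  Matrix.of fun a b => betheEntry α d k (a + 1) (b + 1)

/-- The matrix `T_k` with `ρ` added to its last diagonal entry, which becomes `α d_k + ρ`. -/
noncomputable def matS (α : ℝ) (d : ℕ → ℕ) (k : ℕ) (ρ : ℝ) : Matrix (Fin k) (Fin k) ℝ :=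
  Matrix.of fun a b => betheEntry α d k (a + 1) (b + 1) +
    if (a : ℕ) + 1 = k ∧ (b : ℕ) + 1 = k then ρ else 0

/-- `2α + 2(1 - α) cos(2πi/r)`, for `i = 0, …, r - 1`: the eigenvalues of `A_α(C_r)`, numbered
from `0`. -/
noncomputable def cycleRho (α : ℝ) (r i : ℕ) : ℝ :=
  2 * α + 2 * (1 - α) * Real.cos (2 * Real.pi * i / r)

/-! Give a vertex of the tree the height `k - dist`, so that leaves have height 1 and the root has
height `k`. Eliminating `x - A_α` from the leaves upwards is an LDLᵀ factorization
(`Matrix.det_forest`). Since vertices of equal height have equal degree, the pivot depends only on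
the height `j`. The squared codiagonal entries are β² times the number of children, so this pivot is
`Q_j / Q_{j-1}`, where the `Q_j` (`jacobiPoly`) are the characteristic polynomials of the leading
blocks of the tridiagonal matrix. With ρ added at the root, the tree therefore has characteristic
polynomial ∏ (Q_j/Q_{j-1})^{n_j} = Q_k ∏_{j<k} Q_j^{n_j - n_{j+1}} (`charpoly_mul_prod`,
`rootMultiplicity_charpoly`).

The matrix of the whole graph is 1 ⊗ A_α(B) + A_α(C_r) ⊗ E, where E is the matrix unit at the root.
The Fourier basis of the cycle turns A_α(C_r) into the scalars ρ_i, so the characteristic polynomial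
is the product over i of those of the tree with ρ_i added at the root
(`charpoly_rootedCopies_cycleGraph`). This gives (2), and (1) follows because n_j ≥ n_{j+1}.

For α < 1 the codiagonal has no zero, and positivity of a Wronskian makes all roots simple. For (3),
|ρ_i| ≤ 2 = ρ_1, so a comparison of pivots shows that no `T_j` or `S_i` has an eigenvalue larger in
absolute value than the greatest root for `S_1`. The comparison needs only c_j ≥ 0, so it also
covers α = 1. -/

open Polynomial in
/-- Two real polynomials that agree wherever a nonzero polynomial does not vanish are equal. -/
theorem Polynomial.eq_of_eval_eq_of_eval_ne_zero {p q R : ℝ[X]} (hR : R ≠ 0)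
    (h : ∀ x, R.eval x ≠ 0 → p.eval x = q.eval x) : p = q := by
  apply mul_right_cancel₀ hR
  apply Polynomial.funext
  intro x
  rw [eval_mul, eval_mul]
  by_cases hx : R.eval x = 0
  · simp [hx]
  · rw [h x hx]

/-! ### Three-term recurrences: simple roots, comparison of pivots, greatest root -/

section Jacobi

open Polynomial

/-- The monic polynomials with `Q_0 = 1`, `Q_1 = X - a_1` and
`Q_{j+2} = (X - a_{j+2}) Q_{j+1} - c_{j+2} Q_j`: the characteristic polynomials of the leading
principal submatrices of a symmetric tridiagonal matrix with diagonal `a_1, a_2, …` and squared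
codiagonal `c_2, c_3, …`. -/
noncomputable def jacobiPoly (a c : ℕ → ℝ) : ℕ → ℝ[X]
  | 0 => 1
  | 1 => X - C (a 1)
  | j + 2 => (X - C (a (j + 2))) * jacobiPoly a c (j + 1) - C (c (j + 2)) * jacobiPoly a c j

theorem jacobiPoly_natDegree_monic (a c : ℕ → ℝ) (j : ℕ) :
    (jacobiPoly a c j).natDegree = j ∧ (jacobiPoly a c j).Monic := by
  induction j using Nat.twoStepInduction with
  | zero => simp [jacobiPoly]
  | one => exact ⟨natDegree_X_sub_C _, monic_X_sub_C _⟩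
  | more j h0 h1 =>
    have hd : ((X - C (a (j + 2))) * jacobiPoly a c (j + 1)).natDegree = j + 2 := by
      rw [(monic_X_sub_C _).natDegree_mul h1.2, natDegree_X_sub_C, h1.1]; ring
    have hm := (monic_X_sub_C (a (j + 2))).mul h1.2
    have hlt : (C (c (j + 2)) * jacobiPoly a c j).natDegree < j + 2 :=
      (natDegree_C_mul_le _ _).trans_lt (by omega)
    rw [jacobiPoly]
    refine ⟨?_, ?_⟩
    · rw [natDegree_sub_eq_left_of_natDegree_lt (by omega), hd]
    · exact hm.sub_of_left (degree_lt_degree (by omega))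

theorem jacobiPoly_monic (a c : ℕ → ℝ) (j : ℕ) : (jacobiPoly a c j).Monic :=
  (jacobiPoly_natDegree_monic a c j).2

theorem jacobiPoly_ne_zero (a c : ℕ → ℝ) (j : ℕ) : jacobiPoly a c j ≠ 0 :=
  (jacobiPoly_monic a c j).ne_zero

theorem jacobiPoly_congr {a a' c c' : ℕ → ℝ} {m : ℕ} (ha : ∀ j, 1 ≤ j → j ≤ m → a j = a' j)
    (hc : ∀ j, 2 ≤ j → j ≤ m → c j = c' j) : jacobiPoly a c m = jacobiPoly a' c' m := by
  suffices ∀ j ≤ m, jacobiPoly a c j = jacobiPoly a' c' j from this m le_rfl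
  intro j
  induction j using Nat.twoStepInduction with
  | zero => intro; rfl
  | one => intro h; rw [jacobiPoly, jacobiPoly, ha 1 le_rfl h]
  | more j h0 h1 =>
    intro h
    rw [jacobiPoly, jacobiPoly, h0 (by omega), h1 (by omega), ha _ (by omega) h,
      hc _ (by omega) h]

theorem jacobiPoly_eval_add_two (a c : ℕ → ℝ) (j : ℕ) (x : ℝ) :
    (jacobiPoly a c (j + 2)).eval x =
      (x - a (j + 2)) * (jacobiPoly a c (j + 1)).eval x -
        c (j + 2) * (jacobiPoly a c j).eval x := by
  simp [jacobiPoly]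

/-- The pivots `Q_{j+1} / Q_j` of the elimination. -/
theorem jacobiPoly_pivot_one (a c : ℕ → ℝ) (x : ℝ) :
    (jacobiPoly a c 1).eval x / (jacobiPoly a c 0).eval x = x - a 1 := by
  simp [jacobiPoly]

/-- The recurrence divided by `Q_{j+1}`. A zero of `Q_j` does no harm, since `c / (Q_{j+1} / Q_j) =
c Q_j / Q_{j+1}` also holds under the convention for division by zero. -/
theorem jacobiPoly_pivot_add_two (a c : ℕ → ℝ) (j : ℕ) (x : ℝ)
    (h : (jacobiPoly a c (j + 1)).eval x ≠ 0) :
    (jacobiPoly a c (j + 2)).eval x / (jacobiPoly a c (j + 1)).eval x +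
      c (j + 2) / ((jacobiPoly a c (j + 1)).eval x / (jacobiPoly a c j).eval x) =
      x - a (j + 2) := by
  rw [jacobiPoly_eval_add_two, div_div_eq_mul_div]
  field_simp
  ring

/-- If the codiagonal has no zero, the roots are simple. -/
theorem jacobiPoly_wronskian_pos {a c : ℕ → ℝ} {m : ℕ} (hc : ∀ j, 2 ≤ j → j ≤ m → 0 < c j)
    (x : ℝ) (j : ℕ) (hj : j + 1 ≤ m) :
    0 < (derivative (jacobiPoly a c (j + 1))).eval x * (jacobiPoly a c j).eval x -
      (jacobiPoly a c (j + 1)).eval x * (derivative (jacobiPoly a c j)).eval x := by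
  induction j with
  | zero => simp [jacobiPoly]
  | succ j ih =>
    -- With W_j = Q_{j+1}' Q_j - Q_{j+1} Q_j', the recurrence gives W_{j+1} = Q_{j+1}² + c_{j+2}
    -- W_j.
    have h1 := ih (by omega)
    have h2 := hc (j + 2) (by omega) (by omega)
    have h3 := mul_pos h2 h1
    have h4 := sq_nonneg ((jacobiPoly a c (j + 1)).eval x)
    simp only [jacobiPoly, derivative_sub, derivative_mul, derivative_X, derivative_C, eval_sub,
      eval_add, eval_mul, eval_X, eval_C, eval_one, eval_zero] at h3 ⊢
    nlinarith

theorem jacobiPoly_rootMultiplicity_eq_one {a c : ℕ → ℝ} {m : ℕ}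
    (hc : ∀ j, 2 ≤ j → j ≤ m → 0 < c j) {x : ℝ} (hx : (jacobiPoly a c m).IsRoot x) :
    (jacobiPoly a c m).rootMultiplicity x = 1 := by
  obtain _ | j := m
  · simp [jacobiPoly] at hx
  have hw := jacobiPoly_wronskian_pos (a := a) hc x j le_rfl
  rw [IsRoot.def] at hx
  have h0 : 0 < (jacobiPoly a c (j + 1)).rootMultiplicity x :=
    (rootMultiplicity_pos (jacobiPoly_ne_zero _ _ _)).2 hx
  have h1 : ¬ 1 < (jacobiPoly a c (j + 1)).rootMultiplicity x := by
    rw [one_lt_rootMultiplicity_iff_isRoot (jacobiPoly_ne_zero _ _ _)]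
    rintro ⟨-, h⟩
    rw [IsRoot.def] at h
    simp [hx, h] at hw
  omega

/-- Comparison of the pivots: outside the interval `[-x, x]` the polynomials with the smaller
diagonal have no root if those with the larger diagonal are positive at `x`. -/
theorem jacobiPoly_eval_ne_zero_of_abs_le {a b c : ℕ → ℝ} {m : ℕ} {x y : ℝ}
    (hc : ∀ j, 2 ≤ j → j ≤ m → 0 ≤ c j) (hab : ∀ j, 1 ≤ j → j ≤ m → |b j| ≤ a j)
    (hy : x ≤ |y|) (hpos : ∀ j ≤ m, 0 < (jacobiPoly a c j).eval x) :
    (jacobiPoly b c m).eval y ≠ 0 := by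
  -- The pivots for `b` at `y` dominate in absolute value the positive pivots for `a` at `x`, hence
  -- never vanish.
  suffices ∀ j, j + 1 ≤ m → (jacobiPoly b c j).eval y ≠ 0 ∧
      (jacobiPoly a c (j + 1)).eval x / (jacobiPoly a c j).eval x ≤
        |(jacobiPoly b c (j + 1)).eval y / (jacobiPoly b c j).eval y| by
    obtain _ | j := m
    · simp [jacobiPoly]
    intro h
    have h1 := (this j le_rfl).2
    rw [h] at h1
    have := div_pos (hpos (j + 1) le_rfl) (hpos j (by omega))
    simp at h1
    linarith
  intro j
  induction j with
  | zero =>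
    intro h
    refine ⟨by simp [jacobiPoly], ?_⟩
    rw [jacobiPoly_pivot_one, jacobiPoly_pivot_one]
    have := hab 1 le_rfl h
    have := abs_sub_abs_le_abs_sub y (b 1)
    linarith
  | succ j ih =>
    intro h
    obtain ⟨h1, h2⟩ := ih (by omega)
    have p0 := hpos j (by omega)
    have p1 := hpos (j + 1) (by omega)
    have pp := div_pos p1 p0
    have hne : (jacobiPoly b c (j + 1)).eval y ≠ 0 := by
      intro h3
      rw [h3] at h2
      simp at h2
      linarith
    refine ⟨hne, ?_⟩
    -- The new pivot for `b` is at least |y| - |b_{j+2}| - c_{j+2}/|previous pivot| in absolute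
    -- value, and each term compares with its counterpart for `a`.
    have e1 := jacobiPoly_pivot_add_two a c j x p1.ne'
    have e2 := jacobiPoly_pivot_add_two b c j y hne
    have h4 := hab (j + 2) (by omega) h
    have h5 := abs_sub_abs_le_abs_sub y (b (j + 2))
    have h6 : |c (j + 2) / ((jacobiPoly b c (j + 1)).eval y / (jacobiPoly b c j).eval y)| ≤
        c (j + 2) / ((jacobiPoly a c (j + 1)).eval x / (jacobiPoly a c j).eval x) := by
      rw [abs_div, abs_of_nonneg (hc _ (by omega) h)]
      exact div_le_div_of_nonneg_left (hc _ (by omega) h) pp h2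
    have h7 := abs_add_le
      ((jacobiPoly b c (j + 2)).eval y / (jacobiPoly b c (j + 1)).eval y)
      (c (j + 2) / ((jacobiPoly b c (j + 1)).eval y / (jacobiPoly b c j).eval y))
    rw [e2] at h7
    linarith

/-- `Q_m` has a root to the right of which all of `Q_0, …, Q_m` are positive. -/
theorem jacobiPoly_exists_greatest_root {a c : ℕ → ℝ} {m : ℕ} (hm : 1 ≤ m)
    (hc : ∀ j, 2 ≤ j → j ≤ m → 0 ≤ c j) :
    ∃ ρ, a 1 ≤ ρ ∧ (jacobiPoly a c m).IsRoot ρ ∧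
      ∀ x, ρ < x → ∀ j ≤ m, 0 < (jacobiPoly a c j).eval x := by
  classical
  -- ρ is the greatest root of all the `Q_j` together; it remains to see that `Q_m` itself vanishes
  -- there.
  set s : Finset ℝ := (Finset.range (m + 1)).biUnion fun j => (jacobiPoly a c j).roots.toFinset
  have hs : ∀ x, x ∈ s ↔ ∃ j ≤ m, (jacobiPoly a c j).IsRoot x := by
    intro x
    simp [s, jacobiPoly_ne_zero]
  have h1 : a 1 ∈ s := (hs _).2 ⟨1, hm, by simp [jacobiPoly]⟩
  have hne : s.Nonempty := ⟨_, h1⟩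
  set ρ := s.max' hne
  have hpos : ∀ x, ρ < x → ∀ j ≤ m, 0 < (jacobiPoly a c j).eval x := by
    intro x hx j hj
    by_contra! hneg
    obtain _ | j := j
    · simp [jacobiPoly] at hneg
      linarith
    -- A monic polynomial of positive degree tends to +∞, so a nonpositive value beyond ρ would
    -- force a root beyond ρ.
    have hmon := jacobiPoly_natDegree_monic a c (j + 1)
    have htop : Filter.Tendsto (fun y => (jacobiPoly a c (j + 1)).eval y) Filter.atTop
        Filter.atTop := by
      apply tendsto_atTop_of_leadingCoeff_nonneg
      · rw [degree_eq_natDegree hmon.2.ne_zero, hmon.1]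
        exact_mod_cast Nat.succ_pos j
      · rw [hmon.2.leadingCoeff]; exact zero_le_one
    obtain ⟨y, hy1, hy2⟩ := ((htop.eventually_ge_atTop 0).and
      (Filter.eventually_ge_atTop x)).exists
    obtain ⟨z, hz, hz0⟩ := intermediate_value_Icc hy2
      ((jacobiPoly a c (j + 1)).continuous.continuousOn) ⟨hneg, hy1⟩
    have : z ∈ s := (hs z).2 ⟨j + 1, hj, hz0⟩
    have := s.le_max' z this
    have := hz.1
    linarith
  have hnonneg : ∀ j ≤ m, 0 ≤ (jacobiPoly a c j).eval ρ := by
    intro j hj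
    refine ge_of_tendsto (x := nhdsWithin ρ (Set.Ioi ρ))
      ((jacobiPoly a c j).continuous.continuousWithinAt) ?_
    filter_upwards [self_mem_nhdsWithin] with x hx
    exact (hpos x hx j hj).le
  obtain ⟨i, him, hi⟩ := (hs ρ).1 (s.max'_mem hne)
  refine ⟨ρ, s.le_max' _ h1, ?_, hpos⟩
  -- The root passes upwards: if Q_{i+1}(ρ) = 0, then Q_{i+2}(ρ) = -c_{i+2} Q_i(ρ) ≤ 0, while
  -- Q_{i+2}(ρ) ≥ 0 as a limit from the right.
  induction him using Nat.decreasingInduction with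
  | self => exact hi
  | of_succ i him ih =>
    apply ih
    obtain _ | i := i
    · simp [jacobiPoly] at hi
    rw [IsRoot.def] at hi ⊢
    have h2 := hnonneg (i + 2) him
    have h3 := mul_nonneg (hc (i + 2) (by omega) him) (hnonneg i (by omega))
    have h4 := jacobiPoly_eval_add_two a c i ρ
    rw [hi] at h4
    linarith

end Jacobi

/-! ### Determinants by elimination on a forest -/

open Matrix in
/-- Elimination of a symmetric matrix supported on a forest, from the leaves upwards:
`W u v` is the weight of the edge from `u` to its child `v`, and `δ` are the pivots. -/
theorem Matrix.det_forest {ι : Type*} [Fintype ι] [DecidableEq ι] (h : ι → ℕ) (W : ι → ι → ℝ)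
    (e δ : ι → ℝ) (hh : ∀ u v, W u v ≠ 0 → h v < h u)
    (hW : ∀ u u' v, W u v ≠ 0 → W u' v ≠ 0 → u = u') (hδ : ∀ u, δ u ≠ 0)
    (he : ∀ u, δ u + ∑ v, W u v ^ 2 / δ v = e u) :
    (Matrix.of fun u v => (if u = v then e u else 0) - W u v - W v u).det = ∏ u, δ u := by
  set N : Matrix ι ι ℝ := Matrix.of fun u v => W u v / δ v
  have hN : ∀ u v, ¬ h v < h u → N u v = 0 := by
    intro u v huv
    have : W u v = 0 := by
      by_contra h'
      exact huv (hh _ _ h')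
    simp [N, this]
  have hdet : (1 - N).det = 1 := by
    have htri : (1 - N)ᵀ.BlockTriangular h := by
      intro i j hij
      have : i ≠ j := by rintro rfl; exact lt_irrefl _ hij
      simp [this.symm, hN j i (by omega)]
    rw [← Matrix.det_transpose, htri.det]
    apply Finset.prod_eq_one
    intro i _
    have : (1 - N)ᵀ.toSquareBlock h i = 1 := by
      ext ⟨a, ha⟩ ⟨b, hb⟩
      simp [Matrix.toSquareBlock, Matrix.toSquareBlockProp, Matrix.one_apply,
        hN b a (by omega)]
    rw [this, Matrix.det_one]
  -- In the expansion, N diag(δ) Nᵀ is diagonal because no vertex has two parents; `he` then matches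
  -- the diagonal entries.
  have hprod : (Matrix.of fun u v => (if u = v then e u else 0) - W u v - W v u) =
      (1 - N) * Matrix.diagonal δ * (1 - N)ᵀ := by
    have h1 : N * Matrix.diagonal δ = Matrix.of W := by
      ext u v
      simp [N, hδ]
    have h2 : Matrix.diagonal δ * Nᵀ = (Matrix.of W)ᵀ := by
      rw [← h1, Matrix.transpose_mul, Matrix.diagonal_transpose]
    have h3 : N * Matrix.diagonal δ * Nᵀ =
        Matrix.diagonal fun u => ∑ v, W u v ^ 2 / δ v := by
      rw [h1]
      ext u v
      simp only [Matrix.mul_apply, Matrix.transpose_apply, Matrix.of_apply, N,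
        Matrix.diagonal_apply]
      split_ifs with huv
      · subst huv
        exact Finset.sum_congr rfl fun w _ => by ring
      · apply Finset.sum_eq_zero
        intro w _
        by_contra hne
        exact huv (hW u v w (left_ne_zero_of_mul hne)
          (fun h0 => hne (by simp [h0])))
    have h4 : (1 - N) * Matrix.diagonal δ * (1 - N)ᵀ = Matrix.diagonal δ -
        N * Matrix.diagonal δ - Matrix.diagonal δ * Nᵀ + N * Matrix.diagonal δ * Nᵀ := by
      rw [Matrix.transpose_sub, Matrix.transpose_one]
      noncomm_ring
    rw [h4, h3, h2, h1]
    ext u v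
    simp only [Matrix.of_apply, Matrix.add_apply, Matrix.sub_apply, Matrix.transpose_apply,
      Matrix.diagonal_apply]
    split_ifs with huv
    · rw [← he]; ring
    · ring
  rw [hprod, Matrix.det_mul, Matrix.det_mul, Matrix.det_transpose, hdet, Matrix.det_diagonal]
  ring

open Polynomial in
/-- The characteristic polynomial of a symmetric tridiagonal matrix. -/
theorem Matrix.charpoly_tridiagonal (a w : ℕ → ℝ) (m : ℕ) :
    (Matrix.of fun s t : Fin m => if s = t then a (s + 1)
      else if (s : ℕ) + 1 = t ∨ (t : ℕ) + 1 = s then w (max s t + 1) else 0).charpoly =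
      jacobiPoly a (fun j => w j ^ 2) m := by
  set c : ℕ → ℝ := fun j => w j ^ 2 with hc
  -- It suffices to treat the `x` at which no `Q_j` vanishes, so that all pivots are defined and
  -- nonzero.
  have hR : ∏ j ∈ Finset.range (m + 1), jacobiPoly a c j ≠ 0 :=
    Finset.prod_ne_zero_iff.2 fun j _ => jacobiPoly_ne_zero _ _ _
  refine eq_of_eval_eq_of_eval_ne_zero hR fun x hx => ?_
  rw [eval_prod, Finset.prod_ne_zero_iff] at hx
  replace hx : ∀ j ≤ m, (jacobiPoly a c j).eval x ≠ 0 := fun j hj =>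
    hx j (Finset.mem_range.2 (by omega))
  -- A path is a forest in which the only child of `u` is `u - 1`. The sign of `w` is immaterial, as
  -- only its square enters.
  have key := Matrix.det_forest (ι := Fin m) (fun u => u)
    (fun u v => if (v : ℕ) + 1 = u then w (u + 1) else 0) (fun u => x - a (u + 1))
    (fun u => (jacobiPoly a c (u + 1)).eval x / (jacobiPoly a c u).eval x)
    (fun u v huv => by
      simp only [ne_eq, ite_eq_right_iff, not_forall] at huv
      obtain ⟨h, -⟩ := huv
      omega)
    (fun u u' v h h' => by
      simp only [ne_eq, ite_eq_right_iff, not_forall] at h h'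
      obtain ⟨h, -⟩ := h
      obtain ⟨h', -⟩ := h'
      ext
      omega)
    (fun u => div_ne_zero (hx _ u.2) (hx _ u.2.le))
    (fun u => by
      obtain ⟨u, hu⟩ := u
      obtain _ | u := u
      · simp [jacobiPoly]
      · rw [Finset.sum_eq_single (⟨u, by omega⟩ : Fin m)]
        · simpa [hc] using jacobiPoly_pivot_add_two a c u x (hx _ hu.le)
        · intro b _ hb
          have : (b : ℕ) ≠ u := fun h => hb (Fin.ext h)
          simp [this]
        · simp)
  rw [Matrix.eval_charpoly]
  convert key using 1
  · congr 1
    ext s t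
    simp only [Matrix.sub_apply, Matrix.scalar_apply, Matrix.diagonal_apply, Matrix.of_apply]
    by_cases hst : s = t
    · subst hst
      simp
    · have hst' : (s : ℕ) ≠ t := fun h => hst (Fin.ext h)
      by_cases h1 : (s : ℕ) + 1 = t
      · have h2 : ¬ (t : ℕ) + 1 = s := by omega
        simp [hst, h1, h2, max_eq_right (show (s : ℕ) ≤ t by omega)]
      · by_cases h2 : (t : ℕ) + 1 = s
        · simp [hst, h1, h2, max_eq_left (show (t : ℕ) ≤ s by omega)]
        · simp [hst, h1, h2]
  · rw [Fin.prod_univ_eq_prod_range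
      (fun u => (jacobiPoly a c (u + 1)).eval x / (jacobiPoly a c u).eval x) m]
    have : ∀ j ≤ m, (jacobiPoly a c j).eval x = ∏ u ∈ Finset.range j,
        (jacobiPoly a c (u + 1)).eval x / (jacobiPoly a c u).eval x := by
      intro j
      induction j with
      | zero => simp [jacobiPoly]
      | succ j ih =>
        intro hj
        rw [Finset.prod_range_succ, ← ih (by omega), mul_div_cancel₀ _ (hx j (by omega))]
    exact this m le_rfl

/-! ### Parents and children in a rooted tree -/

namespace SimpleGraph

variable {V : Type*} {G : SimpleGraph V}

/-- In a tree, the neighbour of a vertex that is nearer to the root is unique. -/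
theorem IsTree.eq_of_adj_of_dist_eq (hG : G.IsTree) {r u u' v : V} (h : G.Adj u v)
    (h' : G.Adj u' v) (hd : G.dist r v = G.dist r u + 1) (hd' : G.dist r v = G.dist r u' + 1) :
    u = u' := by
  obtain ⟨p, -, hp⟩ := hG.connected.exists_path_of_dist r u
  obtain ⟨p', -, hp'⟩ := hG.connected.exists_path_of_dist r u'
  have hq : (p.concat h).IsPath :=
    (p.concat h).isPath_of_length_eq_dist (by rw [Walk.length_concat, hp, hd])
  have hq' : (p'.concat h').IsPath :=
    (p'.concat h').isPath_of_length_eq_dist (by rw [Walk.length_concat, hp', hd'])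
  have := congrArg Walk.penultimate ((hG.existsUnique_path r v).unique hq hq')
  simpa using this

theorem Connected.exists_adj_dist_eq (hG : G.Connected) {r v : V} (hv : v ≠ r) :
    ∃ u, G.Adj u v ∧ G.dist r v = G.dist r u + 1 := by
  obtain ⟨p, hp⟩ := hG.exists_walk_length_eq_dist r v
  have hn : ¬ p.Nil := Walk.not_nil_of_ne hv.symm
  have hadj := p.adj_penultimate hn
  refine ⟨p.penultimate, hadj, ?_⟩
  have h1 : G.dist r p.penultimate ≤ p.dropLast.length := dist_le _
  have h2 : p.dropLast.length + 1 = p.length := by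
    have := Walk.not_nil_iff_lt_length.1 hn
    rw [Walk.length_dropLast]
    omega
  have h3 := hG.dist_triangle (u := r) (v := p.penultimate) (w := v)
  rw [dist_eq_one_iff_adj.2 hadj] at h3
  omega

variable [Fintype V] [DecidableRel G.Adj]

/-- The neighbours of `u` that are farther from `r`. -/
noncomputable def children (G : SimpleGraph V) [DecidableRel G.Adj] (r u : V) : Finset V :=
  {v | G.Adj u v ∧ G.dist r v = G.dist r u + 1}

theorem mem_children {r u v : V} :
    v ∈ G.children r u ↔ G.Adj u v ∧ G.dist r v = G.dist r u + 1 := by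
  simp [children]

/-- Adjacent vertices of a tree differ by exactly one in distance from the root, so a neighbour is a
child or the unique parent. -/
theorem IsTree.degree_eq_card_children [DecidableEq V] (hG : G.IsTree) (r u : V) :
    G.degree u = (G.children r u).card + if u = r then 0 else 1 := by
  have hsplit : G.neighborFinset u =
      G.children r u ∪ ({v | G.Adj v u ∧ G.dist r u = G.dist r v + 1} : Finset V) := by
    ext v
    simp only [mem_neighborFinset, Finset.mem_union, mem_children, Finset.mem_filter,
      Finset.mem_univ, true_and]
    constructor
    · intro h
      rcases hG.dist_eq_dist_add_one_of_adj r h with h1 | h1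
      · exact Or.inr ⟨h.symm, h1⟩
      · exact Or.inl ⟨h, h1⟩
    · rintro (h | h)
      · exact h.1
      · exact h.1.symm
  have hdisj : Disjoint (G.children r u)
      ({v | G.Adj v u ∧ G.dist r u = G.dist r v + 1} : Finset V) := by
    rw [Finset.disjoint_left]
    intro v h1 h2
    have := (mem_children.1 h1).2
    have := (Finset.mem_filter.1 h2).2.2
    omega
  rw [← card_neighborFinset_eq_degree, hsplit, Finset.card_union_of_disjoint hdisj]
  congr 1
  split_ifs with hu
  · subst hu
    simp
  · obtain ⟨p, hp, hp'⟩ := hG.connected.exists_adj_dist_eq hu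
    rw [Finset.card_eq_one]
    refine ⟨p, ?_⟩
    ext v
    simp only [Finset.mem_filter, Finset.mem_univ, true_and, Finset.mem_singleton]
    constructor
    · rintro ⟨h1, h2⟩
      exact hG.eq_of_adj_of_dist_eq h1 hp h2 hp'
    · rintro rfl
      exact ⟨hp, hp'⟩

end SimpleGraph

/-! ### Level counts and degrees of a generalized Bethe tree -/

namespace IsGeneralizedBetheTree

variable {V : Type*} [Fintype V] {B : SimpleGraph V} [DecidableRel B.Adj]
  {root : V} {k : ℕ}

theorem dist_lt (hB : IsGeneralizedBetheTree B root k) (v : V) : B.dist root v < k :=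
  hB.level_le v

theorem one_le (hB : IsGeneralizedBetheTree B root k) : 1 ≤ k :=
  (Nat.zero_le _).trans_lt (hB.dist_lt root)

theorem mem_levelFromBottom (hB : IsGeneralizedBetheTree B root k) {j : ℕ} (hj : 1 ≤ j)
    (hjk : j ≤ k) {v : V} : v ∈ levelFromBottom B root k j ↔ k - B.dist root v = j := by
  have := hB.dist_lt v
  rw [levelFromBottom, Finset.mem_filter, vertexLevel]
  simp only [Finset.mem_univ, true_and]
  omega

theorem degree_eq' (hB : IsGeneralizedBetheTree B root k) (v : V) :
    B.degree v = levelDegree B root k (k - B.dist root v) := by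
  have := hB.dist_lt v
  exact hB.degree_eq_levelDegree ((hB.mem_levelFromBottom (by omega) (by omega)).2 rfl)

theorem eq_root_iff (hB : IsGeneralizedBetheTree B root k) {v : V} :
    k - B.dist root v = k ↔ v = root := by
  have := hB.dist_lt v
  rw [← eq_comm (a := root), ← hB.isTree.connected.dist_eq_zero_iff (u := root) (v := v)]
  omega

theorem levelCount_root (hB : IsGeneralizedBetheTree B root k) : levelCount B root k k = 1 := by
  rw [levelCount, Finset.card_eq_one]
  refine ⟨root, ?_⟩
  ext v
  rw [hB.mem_levelFromBottom hB.one_le le_rfl, hB.eq_root_iff, Finset.mem_singleton]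

theorem exists_dist_eq (hB : IsGeneralizedBetheTree B root k) {i : ℕ} (hi : i < k) :
    ∃ v, B.dist root v = i := by
  have hi' : i ≤ k - 1 := by omega
  induction hi' using Nat.decreasingInduction with
  | self =>
    obtain ⟨v, hv⟩ := hB.exists_level
    rw [vertexLevel] at hv
    exact ⟨v, by omega⟩
  | of_succ i hik ih =>
    obtain ⟨v, hv⟩ := ih (by omega)
    have hne : v ≠ root := by
      rintro rfl
      simp at hv
    obtain ⟨u, -, hu⟩ := hB.isTree.connected.exists_adj_dist_eq hne
    exact ⟨u, by omega⟩

/-- The next level is inhabited, so some vertex on the level of `u` has a child; equal degrees on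
that level mean equally many children. -/
theorem children_nonempty (hB : IsGeneralizedBetheTree B root k) {u : V}
    (hu : B.dist root u + 1 < k) : (B.children root u).Nonempty := by
  classical
  obtain ⟨v, hv⟩ := hB.exists_dist_eq hu
  have hne : v ≠ root := by
    rintro rfl
    simp at hv
  obtain ⟨w, hw, hw'⟩ := hB.isTree.connected.exists_adj_dist_eq hne
  have hd : B.dist root w = B.dist root u := by omega
  have h1 := hB.degree_eq w u (by simp [vertexLevel, hd])
  rw [hB.isTree.degree_eq_card_children root, hB.isTree.degree_eq_card_children root] at h1
  have h2 : w = root ↔ u = root := by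
    rw [← hB.eq_root_iff, ← hB.eq_root_iff, hd]
  simp only [h2, add_left_inj] at h1
  rw [← Finset.card_pos, ← h1, Finset.card_pos]
  exact ⟨v, SimpleGraph.mem_children.2 ⟨hw, hw'⟩⟩

/-- Choosing one child for each vertex is injective, by uniqueness of parents. -/
theorem levelCount_succ_le (hB : IsGeneralizedBetheTree B root k) {j : ℕ} (hj : 1 ≤ j)
    (hjk : j ≤ k - 1) : levelCount B root k (j + 1) ≤ levelCount B root k j := by
  have hch : ∀ u ∈ levelFromBottom B root k (j + 1), ∃ v, v ∈ B.children root u := by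
    intro u hu
    have := hB.dist_lt u
    rw [hB.mem_levelFromBottom (by omega) (by omega)] at hu
    exact hB.children_nonempty (by omega)
  choose! f hf using hch
  apply Finset.card_le_card_of_injOn f
  · intro u hu
    have := hB.dist_lt u
    have h1 := (SimpleGraph.mem_children.1 (hf u hu)).2
    rw [Finset.mem_coe, hB.mem_levelFromBottom (by omega) (by omega)] at hu
    rw [Finset.mem_coe, hB.mem_levelFromBottom (by omega) (by omega)]
    omega
  · intro u hu u' hu' huu
    have h1 := SimpleGraph.mem_children.1 (hf u hu)
    have h2 := SimpleGraph.mem_children.1 (hf u' hu')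
    rw [← huu] at h2
    exact hB.isTree.eq_of_adj_of_dist_eq h1.1 h2.1 h1.2 h2.2

theorem two_le_levelDegree (hB : IsGeneralizedBetheTree B root k) {j : ℕ} (hj : 2 ≤ j)
    (hjk : j < k) : 2 ≤ levelDegree B root k j := by
  classical
  obtain ⟨u, hu⟩ := hB.exists_dist_eq (i := k - j) (by omega)
  have h1 := hB.degree_eq' u
  have h2 := Finset.card_pos.2 (hB.children_nonempty (u := u) (by omega))
  rw [hB.isTree.degree_eq_card_children root, if_neg] at h1
  · rw [show k - B.dist root u = j by omega] at h1
    omega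
  · rw [← hB.eq_root_iff]
    omega

theorem one_le_levelDegree_root (hB : IsGeneralizedBetheTree B root k) (hk : 2 ≤ k) :
    1 ≤ levelDegree B root k k := by
  classical
  have h1 := hB.degree_eq' root
  have h2 := Finset.card_pos.2 (hB.children_nonempty (u := root) (by simp; omega))
  rw [hB.isTree.degree_eq_card_children root, SimpleGraph.dist_self, Nat.sub_zero] at h1
  omega

end IsGeneralizedBetheTree

/-! ### Characteristic polynomial of the tree with a weight at the root -/

/-- The diagonal `α d_1, …, α d_{k-1}, α d_k + ρ`. -/
noncomputable def betheDiag (α : ℝ) (d : ℕ → ℕ) (k : ℕ) (ρ : ℝ) (j : ℕ) : ℝ :=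
  α * d j + if j = k then ρ else 0

/-- The squares of the codiagonal entries: `β²` times the number of children. -/
noncomputable def betheSq (α : ℝ) (d : ℕ → ℕ) (k j : ℕ) : ℝ :=
  (1 - α) ^ 2 * if j = k then (d k : ℝ) else (d j : ℝ) - 1

namespace IsGeneralizedBetheTree

variable {V : Type*} [Fintype V] [DecidableEq V] {B : SimpleGraph V} [DecidableRel B.Adj]
  {root : V} {k : ℕ}

theorem betheSq_eq_card_children (hB : IsGeneralizedBetheTree B root k) (α : ℝ) (u : V) :
    betheSq α (levelDegree B root k) k (k - B.dist root u) =
      (1 - α) ^ 2 * (B.children root u).card := by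
  have h1 := hB.isTree.degree_eq_card_children root u
  rw [hB.degree_eq'] at h1
  rw [betheSq]
  congr 1
  by_cases hu : u = root
  · rw [if_pos (hB.eq_root_iff.2 hu)]
    rw [if_pos hu, hB.eq_root_iff.2 hu] at h1
    exact_mod_cast h1
  · rw [if_neg (mt hB.eq_root_iff.1 hu)]
    rw [if_neg hu] at h1
    rw [h1]
    push_cast
    ring

open Polynomial in
/-- The characteristic polynomial of `A_α` of the tree, with `ρ` added at the root. -/
theorem charpoly_mul_prod (hB : IsGeneralizedBetheTree B root k) (α ρ : ℝ) :
    (alphaMatrix α B + Matrix.diagonal fun v => if v = root then ρ else 0).charpoly *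
      ∏ v, jacobiPoly (betheDiag α (levelDegree B root k) k ρ)
        (betheSq α (levelDegree B root k) k) (k - B.dist root v - 1) =
      ∏ v, jacobiPoly (betheDiag α (levelDegree B root k) k ρ)
        (betheSq α (levelDegree B root k) k) (k - B.dist root v) := by
  set d := levelDegree B root k with hd
  set a := betheDiag α d k ρ with ha
  set c := betheSq α d k with hc
  set h : V → ℕ := fun v => k - B.dist root v with hh
  have hR : ∏ j ∈ Finset.range (k + 1), jacobiPoly a c j ≠ 0 :=
    Finset.prod_ne_zero_iff.2 fun j _ => jacobiPoly_ne_zero _ _ _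
  refine eq_of_eval_eq_of_eval_ne_zero hR fun x hx => ?_
  rw [eval_prod, Finset.prod_ne_zero_iff] at hx
  replace hx : ∀ j ≤ k, (jacobiPoly a c j).eval x ≠ 0 := fun j hj =>
    hx j (Finset.mem_range.2 (by omega))
  -- All children of `v` have height `h v - 1`, hence the same pivot. The truncated `h v - 2` at a
  -- leaf is harmless, as the sum is then empty.
  have hpiv : ∀ v, ∑ w ∈ B.children root v, (1 - α) ^ 2 /
      ((jacobiPoly a c (h w)).eval x / (jacobiPoly a c (h w - 1)).eval x) =
      (B.children root v).card * ((1 - α) ^ 2 /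
        ((jacobiPoly a c (h v - 1)).eval x / (jacobiPoly a c (h v - 2)).eval x)) := by
    intro v
    rw [← nsmul_eq_mul]
    apply Finset.sum_eq_card_nsmul
    intro w hw
    have h1 := (SimpleGraph.mem_children.1 hw).2
    rw [show h w - 1 = h v - 2 by simp only [hh]; omega,
      show h w = h v - 1 by simp only [hh]; omega]
  have key := Matrix.det_forest h (fun u v => if v ∈ B.children root u then 1 - α else 0)
    (fun u => x - a (h u))
    (fun u => (jacobiPoly a c (h u)).eval x / (jacobiPoly a c (h u - 1)).eval x)
    (fun u v huv => by
      simp only [ne_eq, ite_eq_right_iff, not_forall] at huv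
      obtain ⟨h1, -⟩ := huv
      have h1 := (SimpleGraph.mem_children.1 h1).2
      have := hB.dist_lt v
      simp only [hh]
      omega)
    (fun u u' v h h' => by
      simp only [ne_eq, ite_eq_right_iff, not_forall] at h h'
      obtain ⟨h, -⟩ := h
      obtain ⟨h', -⟩ := h'
      have h := SimpleGraph.mem_children.1 h
      have h' := SimpleGraph.mem_children.1 h'
      exact hB.isTree.eq_of_adj_of_dist_eq h.1 h'.1 h.2 h'.2)
    (fun u => div_ne_zero (hx _ (by simp only [hh]; omega)) (hx _ (by simp only [hh]; omega)))
    (fun u => by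
      have hsum : ∑ v, (if v ∈ B.children root u then 1 - α else 0) ^ 2 /
          ((jacobiPoly a c (h v)).eval x / (jacobiPoly a c (h v - 1)).eval x) =
          ∑ v ∈ B.children root u, (1 - α) ^ 2 /
            ((jacobiPoly a c (h v)).eval x / (jacobiPoly a c (h v - 1)).eval x) := by
        rw [← Finset.sum_filter_add_sum_filter_not Finset.univ (· ∈ B.children root u)]
        rw [Finset.filter_mem_eq_inter, Finset.univ_inter]
        rw [Finset.sum_congr rfl fun v hv => by rw [if_pos hv], add_eq_left]
        apply Finset.sum_eq_zero
        intro v hv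
        rw [if_neg (Finset.mem_filter.1 hv).2]
        simp
      rw [hsum, hpiv]
      have h1 : 1 ≤ h u := by have := hB.dist_lt u; simp only [hh]; omega
      have h2 : h u ≤ k := Nat.sub_le _ _
      have h3 : c (h u) = (1 - α) ^ 2 * (B.children root u).card :=
        hB.betheSq_eq_card_children α u
      obtain h4 | ⟨i, hi⟩ : h u = 1 ∨ ∃ i, h u = i + 2 := by
        rcases Nat.exists_eq_add_of_le h1 with ⟨_ | i, hi⟩
        · exact Or.inl hi
        · exact Or.inr ⟨i, by omega⟩
      · have h5 : (B.children root u).card = 0 := by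
          rw [Finset.card_eq_zero, Finset.eq_empty_iff_forall_notMem]
          intro v hv
          have := (SimpleGraph.mem_children.1 hv).2
          have := hB.dist_lt v
          simp only [hh] at h4
          omega
        rw [h4, h5]
        simp [jacobiPoly]
      · have := jacobiPoly_pivot_add_two a c i x (hx _ (by omega))
        rw [hi] at h3 ⊢
        rw [← this, h3]
        simp only [Nat.add_sub_cancel, show i + 2 - 1 = i + 1 by omega]
        ring)
  have hmat : Matrix.scalar V x -
      (alphaMatrix α B + Matrix.diagonal fun v => if v = root then ρ else 0) =
      Matrix.of fun u v => (if u = v then x - a (h u) else 0) -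
        (if v ∈ B.children root u then 1 - α else 0) -
        (if u ∈ B.children root v then 1 - α else 0) := by
    ext u v
    simp only [alphaMatrix, SimpleGraph.degMatrix, Matrix.sub_apply, Matrix.add_apply,
      Matrix.smul_apply, Matrix.scalar_apply, Matrix.diagonal_apply, Matrix.of_apply,
      SimpleGraph.adjMatrix_apply, smul_eq_mul, SimpleGraph.mem_children]
    by_cases huv : u = v
    · subst huv
      have h1 : h u = k ↔ u = root := hB.eq_root_iff
      simp only [if_true, ha, betheDiag, h1, hB.degree_eq' u, SimpleGraph.irrefl, false_and,
        if_false]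
      simp only [hh, hd]
      ring
    · by_cases hadj : B.Adj u v
      · rcases hB.isTree.dist_eq_dist_add_one_of_adj root hadj with h1 | h1
        · have h2 : ¬ B.dist root v = B.dist root u + 1 := by omega
          simp only [if_neg huv]
          rw [if_pos hadj, if_neg (fun h => h2 h.2),
            if_pos ⟨hadj.symm, h1⟩]
          ring
        · have h2 : ¬ B.dist root u = B.dist root v + 1 := by omega
          simp only [if_neg huv]
          rw [if_pos hadj, if_pos ⟨hadj, h1⟩,
            if_neg (fun h => h2 h.2)]
          ring
      · have hadj' : ¬ B.Adj v u := fun h => hadj h.symm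
        simp [huv, hadj, hadj']
  rw [eval_mul, Matrix.eval_charpoly, hmat, key, eval_prod, eval_prod, ← Finset.prod_mul_distrib]
  refine Finset.prod_congr rfl fun v _ => ?_
  exact div_mul_cancel₀ _ (hx _ ((Nat.sub_le _ 1).trans (Nat.sub_le _ _)))

end IsGeneralizedBetheTree

/-- Abel summation; it turns the exponents `n_j` of the pivots `Q_j / Q_{j-1}` into the exponents
`n_j - n_{j+1}` of the `Q_j`. -/
theorem Finset.sum_Icc_mul_sub_pred (n m : ℕ → ℤ) (hm : m 0 = 0) {k : ℕ} (hk : 1 ≤ k) :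
    ∑ j ∈ Finset.Icc 1 k, n j * (m j - m (j - 1)) =
      ∑ j ∈ Finset.Icc 1 (k - 1), (n j - n (j + 1)) * m j + n k * m k := by
  induction k, hk using Nat.le_induction with
  | base => simp [hm]
  | succ k hk ih =>
    rw [Finset.sum_Icc_succ_top (by omega), ih, Nat.add_sub_cancel]
    obtain ⟨k, rfl⟩ := Nat.exists_eq_add_of_le' hk
    rw [Nat.add_sub_cancel, Finset.sum_Icc_succ_top (by omega)]
    ring

namespace IsGeneralizedBetheTree

variable {V : Type*} [Fintype V] {B : SimpleGraph V} [DecidableRel B.Adj] {root : V} {k : ℕ}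

theorem sq_codiagonal (hB : IsGeneralizedBetheTree B root k) (α : ℝ) {j : ℕ} (hj : 2 ≤ j)
    (hjk : j ≤ k) :
    ((1 - α) * (if j = k then √(levelDegree B root k k : ℝ)
      else √((levelDegree B root k j : ℝ) - 1))) ^ 2 = betheSq α (levelDegree B root k) k j := by
  rw [mul_pow, betheSq]
  congr 1
  split_ifs with h
  · exact Real.sq_sqrt (Nat.cast_nonneg _)
  · have h2 : (2 : ℝ) ≤ levelDegree B root k j := by
      exact_mod_cast hB.two_le_levelDegree hj (by omega)
    exact Real.sq_sqrt (by linarith)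

theorem betheSq_nonneg (hB : IsGeneralizedBetheTree B root k) (α : ℝ) {j : ℕ} (hj : 2 ≤ j)
    (hjk : j ≤ k) : 0 ≤ betheSq α (levelDegree B root k) k j :=
  hB.sq_codiagonal α hj hjk ▸ sq_nonneg _

theorem betheSq_pos (hB : IsGeneralizedBetheTree B root k) {α : ℝ} (hα : α < 1) {j : ℕ}
    (hj : 2 ≤ j) (hjk : j ≤ k) : 0 < betheSq α (levelDegree B root k) k j := by
  have h1 : 0 < (1 - α) ^ 2 := pow_pos (by linarith) 2
  apply mul_pos h1
  split_ifs with h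
  · exact_mod_cast hB.one_le_levelDegree_root (by omega)
  · have h2 : (2 : ℝ) ≤ levelDegree B root k j := by
      exact_mod_cast hB.two_le_levelDegree hj (by omega)
    linarith

theorem charpoly_matS (hB : IsGeneralizedBetheTree B root k) (α ρ : ℝ) :
    (matS α (levelDegree B root k) k ρ).charpoly =
      jacobiPoly (betheDiag α (levelDegree B root k) k ρ)
        (betheSq α (levelDegree B root k) k) k := by
  rw [← jacobiPoly_congr (fun _ _ _ => rfl) (fun j hj hjk => hB.sq_codiagonal α hj hjk),
    ← Matrix.charpoly_tridiagonal _ (fun j => (1 - α) *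
      (if j = k then √(levelDegree B root k k : ℝ) else √((levelDegree B root k j : ℝ) - 1)))]
  congr 1
  ext s t
  have hmax : max ((s : ℕ) + 1) ((t : ℕ) + 1) = ((max s t : Fin k) : ℕ) + 1 := by
    rw [Nat.add_max_add_right]; rfl
  simp only [matS, betheEntry, betheDiag, Matrix.of_apply, Fin.ext_iff, Nat.add_right_cancel_iff]
  by_cases h : (s : ℕ) = t
  · simp [h]
  · have : ¬ ((s : ℕ) + 1 = k ∧ (t : ℕ) + 1 = k) := by omega
    simp only [h, this, if_false, add_zero, hmax]

/-- The weight ρ enters only the `k`-th diagonal entry, so it is arbitrary here, and one family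
`Q_j` serves both the `T_j` and any `S_i`. -/
theorem charpoly_matT (hB : IsGeneralizedBetheTree B root k) (α ρ : ℝ) {j : ℕ} (hj : j < k) :
    (matT α (levelDegree B root k) k j).charpoly =
      jacobiPoly (betheDiag α (levelDegree B root k) k ρ)
        (betheSq α (levelDegree B root k) k) j := by
  rw [← jacobiPoly_congr (a := fun j => α * levelDegree B root k j)
      (fun i _ hi => by simp [betheDiag, show i ≠ k by omega])
      (fun i hi hij => hB.sq_codiagonal α hi (by omega)),
    ← Matrix.charpoly_tridiagonal _ (fun j => (1 - α) *
      (if j = k then √(levelDegree B root k k : ℝ) else √((levelDegree B root k j : ℝ) - 1)))]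
  congr 1
  ext s t
  have hmax : max ((s : ℕ) + 1) ((t : ℕ) + 1) = ((max s t : Fin j) : ℕ) + 1 := by
    rw [Nat.add_max_add_right]; rfl
  simp only [matT, betheEntry, Matrix.of_apply, Fin.ext_iff, Nat.add_right_cancel_iff]
  by_cases h : (s : ℕ) = t
  · simp [h]
  · simp only [h, if_false, hmax]

open Polynomial in
/-- The multiplicities of the eigenvalues of `A_α` of the tree, with `ρ` added at the root. -/
theorem rootMultiplicity_charpoly [DecidableEq V] (hB : IsGeneralizedBetheTree B root k)
    (α ρ μ : ℝ) :
    ((alphaMatrix α B + Matrix.diagonal fun v => if v = root then ρ else 0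
        ).charpoly.rootMultiplicity μ : ℤ) =
      ∑ j ∈ Finset.Icc 1 (k - 1),
        ((levelCount B root k j : ℤ) - (levelCount B root k (j + 1) : ℤ)) *
        ((matT α (levelDegree B root k) k j).charpoly.rootMultiplicity μ : ℤ) +
      ((matS α (levelDegree B root k) k ρ).charpoly.rootMultiplicity μ : ℤ) := by
  have key := hB.charpoly_mul_prod α ρ
  set Q := jacobiPoly (betheDiag α (levelDegree B root k) k ρ)
    (betheSq α (levelDegree B root k) k) with hQ
  have hQ0 : ∀ j, Q j ≠ 0 := jacobiPoly_ne_zero _ _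
  have hprod : ∀ f : V → ℕ, (∏ v, Q (f v)).rootMultiplicity μ =
      ∑ v, (Q (f v)).rootMultiplicity μ := by
    intro f
    simp only [← count_roots]
    rw [roots_prod _ _ (Finset.prod_ne_zero_iff.2 fun v _ => hQ0 _), Multiset.count_bind]
    rfl
  have h1 := congrArg (rootMultiplicity μ) key
  rw [rootMultiplicity_mul (mul_ne_zero (Matrix.charpoly_monic _).ne_zero
    (Finset.prod_ne_zero_iff.2 fun v _ => hQ0 _)), hprod, hprod] at h1
  have h2 := Finset.sum_Icc_mul_sub_pred (fun j => (levelCount B root k j : ℤ))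
    (fun j => ((Q j).rootMultiplicity μ : ℤ)) (by simp [hQ, jacobiPoly, rootMultiplicity_eq_zero])
    hB.one_le
  -- Vertices are grouped by height.
  have h3 : ∑ v, (((Q (k - B.dist root v)).rootMultiplicity μ : ℤ) -
      ((Q (k - B.dist root v - 1)).rootMultiplicity μ : ℤ)) =
      ∑ j ∈ Finset.Icc 1 k, (levelCount B root k j : ℤ) *
        (((Q j).rootMultiplicity μ : ℤ) - ((Q (j - 1)).rootMultiplicity μ : ℤ)) := by
    rw [← Finset.sum_fiberwise_of_maps_to (s := Finset.univ) (t := Finset.Icc 1 k)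
      (g := fun v => k - B.dist root v)]
    · refine Finset.sum_congr rfl fun j hj => ?_
      rw [Finset.mem_Icc] at hj
      rw [levelCount, ← nsmul_eq_mul]
      have h4 : levelFromBottom B root k j =
          (Finset.univ.filter fun v => k - B.dist root v = j) := by
        ext v
        rw [hB.mem_levelFromBottom hj.1 hj.2, Finset.mem_filter]
        simp
      rw [h4]
      apply Finset.sum_eq_card_nsmul
      intro v hv
      rw [(Finset.mem_filter.1 hv).2]
    · intro v _
      have := hB.dist_lt v
      rw [Finset.mem_Icc]
      omega
  rw [h2, hB.levelCount_root, Finset.sum_sub_distrib] at h3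
  rw [hB.charpoly_matS, ← hQ, Finset.sum_congr rfl (g := fun j =>
    ((levelCount B root k j : ℤ) - (levelCount B root k (j + 1) : ℤ)) *
      ((Q j).rootMultiplicity μ : ℤ))]
  · zify at h1
    simp only [Nat.cast_one, one_mul] at h3
    linarith
  · intro j hj
    rw [Finset.mem_Icc] at hj
    rw [hB.charpoly_matT α ρ (by omega)]

end IsGeneralizedBetheTree

/-! ### Decoupling the copies along the cycle -/

open Kronecker in
/-- If `F` diagonalizes `C`, then `1 ⊗ M + C ⊗ E` is similar to a block diagonal matrix. -/
theorem Matrix.det_one_kronecker_add_kronecker {ι V : Type*} [Fintype ι] [DecidableEq ι]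
    [Fintype V] [DecidableEq V] (C F : Matrix ι ι ℂ) (D : ι → ℂ) (M E : Matrix V V ℂ)
    (hF : F.det ≠ 0) (hC : C * F = F * Matrix.diagonal D) :
    (1 ⊗ₖ M + C ⊗ₖ E).det = ∏ i, (M + D i • E).det := by
  have h1 : (1 ⊗ₖ M + C ⊗ₖ E) * (F ⊗ₖ (1 : Matrix V V ℂ)) =
      (F ⊗ₖ (1 : Matrix V V ℂ)) * (1 ⊗ₖ M + Matrix.diagonal D ⊗ₖ E) := by
    rw [add_mul, mul_add, ← Matrix.mul_kronecker_mul, ← Matrix.mul_kronecker_mul,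
      ← Matrix.mul_kronecker_mul, ← Matrix.mul_kronecker_mul, hC]
    simp
  have h2 : 1 ⊗ₖ M + Matrix.diagonal D ⊗ₖ E = Matrix.reindex (Equiv.prodComm _ _)
      (Equiv.prodComm _ _) (Matrix.blockDiagonal fun i => M + D i • E) := by
    rw [← Matrix.diagonal_one, Matrix.diagonal_kronecker, Matrix.diagonal_kronecker]
    ext ⟨i, u⟩ ⟨j, v⟩
    simp only [Matrix.add_apply, Matrix.reindex_apply, Matrix.submatrix_apply,
      Equiv.prodComm_symm, Equiv.prodComm_apply, Prod.swap_prod_mk, Matrix.blockDiagonal_apply,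
      Matrix.smul_apply]
    split_ifs <;> simp
  have h3 : (F ⊗ₖ (1 : Matrix V V ℂ)).det ≠ 0 := by
    rw [Matrix.det_kronecker]
    simp [hF]
  have h4 := congrArg Matrix.det h1
  rw [Matrix.det_mul, Matrix.det_mul, mul_comm, h2, Matrix.det_reindex_self,
    Matrix.det_blockDiagonal] at h4
  exact mul_left_cancel₀ h3 h4

theorem SimpleGraph.degree_eq_sum_adjMatrix {V : Type*} [Fintype V] (G : SimpleGraph V)
    [DecidableRel G.Adj] (u : V) : (G.degree u : ℝ) = ∑ v, G.adjMatrix ℝ u v := by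
  have := G.adjMatrix_mulVec_const_apply (α := ℝ) (a := 1) (v := u)
  rw [mul_one] at this
  rw [← this]
  simp [Matrix.mulVec, dotProduct]

theorem rootedCopies_adj {ι V : Type*} (R : SimpleGraph ι) (H : SimpleGraph V) (root : V)
    (x y : ι × V) : (rootedCopies R H root).Adj x y ↔
      (x.1 = y.1 ∧ H.Adj x.2 y.2) ∨ (R.Adj x.1 y.1 ∧ x.2 = root ∧ y.2 = root) :=
  Iff.rfl

open Kronecker in
theorem adjMatrix_rootedCopies {ι V : Type*} [DecidableEq ι] [DecidableEq V]
    (R : SimpleGraph ι) (H : SimpleGraph V) (root : V) [DecidableRel R.Adj] [DecidableRel H.Adj] :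
    (rootedCopies R H root).adjMatrix ℝ =
      1 ⊗ₖ H.adjMatrix ℝ + R.adjMatrix ℝ ⊗ₖ Matrix.single root root 1 := by
  ext ⟨i, u⟩ ⟨j, v⟩
  simp only [SimpleGraph.adjMatrix_apply, Matrix.add_apply, Matrix.kronecker_apply,
    Matrix.one_apply, rootedCopies_adj, Matrix.single_apply]
  by_cases hij : i = j
  · subst hij
    simp
  · simp only [hij, false_and, false_or, if_false, zero_mul, zero_add, eq_comm (a := root)]
    by_cases hR : R.Adj i j <;> simp [hR]

open Kronecker in
-- At an identified vertex the degrees in the two graphs add, so the degree matrix splits in the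
-- same way as the adjacency matrix.
theorem alphaMatrix_rootedCopies {ι V : Type*} [Fintype ι] [Fintype V] [DecidableEq ι]
    [DecidableEq V] (α : ℝ) (R : SimpleGraph ι) (H : SimpleGraph V) (root : V)
    [DecidableRel R.Adj] [DecidableRel H.Adj] :
    alphaMatrix α (rootedCopies R H root) =
      1 ⊗ₖ alphaMatrix α H + alphaMatrix α R ⊗ₖ Matrix.single root root 1 := by
  have hdeg : ∀ x : ι × V, ((rootedCopies R H root).degree x : ℝ) =
      H.degree x.2 + if x.2 = root then (R.degree x.1 : ℝ) else 0 := by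
    rintro ⟨i, u⟩
    simp only [SimpleGraph.degree_eq_sum_adjMatrix]
    rw [adjMatrix_rootedCopies, Fintype.sum_prod_type]
    simp only [Matrix.add_apply, Matrix.kronecker_apply, Finset.sum_add_distrib,
      ← Finset.mul_sum, ← Finset.sum_mul, Matrix.one_apply, Matrix.single_apply]
    by_cases hu : root = u
    · simp [hu]
    · simp [hu, eq_comm (a := u)]
  rw [alphaMatrix, adjMatrix_rootedCopies]
  ext ⟨i, u⟩ ⟨j, v⟩
  simp only [alphaMatrix, SimpleGraph.degMatrix, Matrix.add_apply, Matrix.smul_apply,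
    Matrix.kronecker_apply, Matrix.one_apply, Matrix.diagonal_apply, hdeg, Matrix.single_apply,
    smul_eq_mul, Prod.mk.injEq]
  by_cases hij : i = j
  · subst hij
    by_cases huv : u = v
    · subst huv
      by_cases hu : u = root
      · simp [hu]
        ring
      · simp [hu, Ne.symm hu]
    · have : ¬ (root = u ∧ root = v) := fun h => huv (h.1.symm.trans h.2)
      simp [huv, this]
  · simp [hij]

theorem Matrix.adjMatrix_cycleGraph_mul_apply (n : ℕ) (F : Matrix (Fin (n + 3)) (Fin (n + 3)) ℂ)
    (v i : Fin (n + 3)) :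
    ((SimpleGraph.cycleGraph (n + 3)).adjMatrix ℂ * F) v i = F (v - 1) i + F (v + 1) i := by
  -- This is where a length of at least 3 matters: the two neighbours are distinct.
  have hne : v - 1 ≠ v + 1 := by
    intro h
    have h2 : (1 + 1 : Fin (n + 3)) = 0 := by
      rw [sub_eq_iff_eq_add, add_assoc] at h
      exact (left_eq_add.1 h)
    have := congrArg Fin.val h2
    simp [Fin.val_add, Nat.mod_eq_of_lt (show 2 < n + 3 by omega)] at this
  rw [SimpleGraph.adjMatrix_mul_apply, SimpleGraph.cycleGraph_neighborFinset,
    Finset.sum_pair hne]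

/-- The Fourier basis diagonalizes `A_α` of a cycle, with the eigenvalues `cycleRho α r i`. -/
theorem exists_diagonalization_cycleGraph (α : ℝ) {r : ℕ} (hr : 3 ≤ r) :
    ∃ F : Matrix (Fin r) (Fin r) ℂ, F.det ≠ 0 ∧
      (alphaMatrix α (SimpleGraph.cycleGraph r)).map (algebraMap ℝ ℂ) * F =
        F * Matrix.diagonal fun i : Fin r => ((cycleRho α r i : ℝ) : ℂ) := by
  obtain ⟨n, rfl⟩ := Nat.exists_eq_add_of_le' hr
  set r := n + 3 with hrdef
  have hprim := Complex.isPrimitiveRoot_exp r (by omega)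
  set ζ := Complex.exp (2 * Real.pi * Complex.I / r) with hζ
  -- Column `i` is the character v ↦ ζ^{iv}.
  refine ⟨(Matrix.vandermonde fun i : Fin r => ζ ^ (i : ℕ)).transpose, ?_, ?_⟩
  · rw [Matrix.det_transpose, Matrix.det_vandermonde_ne_zero_iff]
    intro i j hij
    exact Fin.ext (hprim.pow_inj i.2 j.2 hij)
  · have hmap : (alphaMatrix α (SimpleGraph.cycleGraph r)).map (algebraMap ℝ ℂ) =
        (2 * α : ℂ) • (1 : Matrix (Fin r) (Fin r) ℂ) +
          (1 - α : ℂ) • (SimpleGraph.cycleGraph r).adjMatrix ℂ := by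
      have hdeg : ∀ u, (SimpleGraph.cycleGraph r).degree u = 2 := fun u =>
        SimpleGraph.cycleGraph_degree_three_le
      ext u v
      simp only [alphaMatrix, SimpleGraph.degMatrix, Matrix.map_apply, Matrix.add_apply,
        Matrix.smul_apply, SimpleGraph.adjMatrix_apply, Matrix.one_apply, Matrix.diagonal_apply,
        hdeg]
      by_cases huv : u = v
      · simp [huv]
        ring
      · by_cases hadj : (SimpleGraph.cycleGraph r).Adj u v <;> simp [huv, hadj]
    rw [hmap]
    ext v i
    rw [add_mul, Matrix.mul_diagonal, Matrix.smul_mul, Matrix.smul_mul, one_mul, Matrix.add_apply,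
      Matrix.smul_apply, Matrix.smul_apply, Matrix.adjMatrix_cycleGraph_mul_apply]
    simp only [Matrix.transpose_apply, Matrix.vandermonde_apply, smul_eq_mul]
    set z := ζ ^ (i : ℕ) with hz
    have hz1 : z ^ r = 1 := by rw [hz, ← pow_mul, mul_comm, pow_mul, hprim.pow_eq_one, one_pow]
    have hz0 : z ≠ 0 := by rintro h; rw [h, zero_pow (by omega)] at hz1; exact zero_ne_one hz1
    have hsucc : ∀ w : Fin r, z ^ ((w + 1 : Fin r) : ℕ) = z ^ (w : ℕ) * z := by
      intro w
      rw [← pow_succ, Fin.val_add, ← pow_eq_pow_mod _ hz1]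
      simp [hrdef]
    have hpred : z ^ ((v - 1 : Fin r) : ℕ) = z ^ (v : ℕ) * z⁻¹ := by
      have := hsucc (v - 1)
      rw [sub_add_cancel] at this
      rw [this, mul_assoc, mul_inv_cancel₀ hz0, mul_one]
    have hcos : z + z⁻¹ = 2 * Complex.cos (2 * Real.pi * i / r) := by
      rw [Complex.two_cos, hz, hζ, ← Complex.exp_nat_mul, ← Complex.exp_neg]
      congr 2 <;> ring
    rw [hsucc, hpred]
    have : (cycleRho α r i : ℂ) = 2 * α + (1 - α) * (z + z⁻¹) := by
      rw [hcos, cycleRho]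
      push_cast
      ring
    rw [this]
    ring

open Polynomial Kronecker in
/-- The copies of the tree decouple in the Fourier basis of the cycle. -/
theorem charpoly_rootedCopies_cycleGraph {V : Type*} [Fintype V] [DecidableEq V]
    (H : SimpleGraph V) [DecidableRel H.Adj] (root : V) (α : ℝ) {r : ℕ} (hr : 3 ≤ r) :
    (alphaMatrix α (rootedCopies (SimpleGraph.cycleGraph r) H root)).charpoly =
      ∏ i : Fin r, (alphaMatrix α H +
        Matrix.diagonal fun v => if v = root then cycleRho α r i else 0).charpoly := by
  obtain ⟨F, hF, hC⟩ := exists_diagonalization_cycleGraph α hr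
  apply Polynomial.funext
  intro x
  rw [eval_prod, Matrix.eval_charpoly, alphaMatrix_rootedCopies]
  simp only [Matrix.eval_charpoly]
  -- The Fourier basis is complex, so the real determinants are compared in ℂ.
  apply (algebraMap ℝ ℂ).injective
  rw [map_prod, RingHom.map_det]
  simp only [RingHom.map_det]
  have := Matrix.det_one_kronecker_add_kronecker _ F _
    ((Matrix.scalar V x - alphaMatrix α H).map (algebraMap ℝ ℂ))
    (-Matrix.single root root 1) hF hC
  convert this using 2
  · ext ⟨i, u⟩ ⟨j, v⟩
    simp only [RingHom.mapMatrix_apply, Matrix.map_apply, Matrix.sub_apply, Matrix.add_apply,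
      Matrix.neg_apply, Matrix.kronecker_apply, Matrix.scalar_apply, Matrix.diagonal_apply,
      Matrix.one_apply, Prod.mk.injEq, Matrix.single_apply]
    by_cases hij : i = j <;> by_cases huv : u = v <;> simp [hij, huv] <;> split_ifs <;>
      push_cast <;> ring
  · congr 1
    ext u v
    simp only [RingHom.mapMatrix_apply, Matrix.map_apply, Matrix.sub_apply, Matrix.add_apply,
      Matrix.neg_apply, Matrix.scalar_apply, Matrix.diagonal_apply, Matrix.smul_apply,
      Matrix.single_apply]
    by_cases huv : u = v
    · subst huv
      by_cases hu : u = root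
      · simp [hu]
        ring
      · simp [hu, Ne.symm hu]
    · have : ¬ (root = u ∧ root = v) := fun h => huv (h.1.symm.trans h.2)
      simp [huv, this]

/-! ### Spectrum, multiplicities and spectral radius -/

theorem Matrix.mem_spectrum_iff_rootMultiplicity_charpoly_pos {n : Type*} [Fintype n]
    [DecidableEq n] (M : Matrix n n ℝ) (μ : ℝ) :
    μ ∈ spectrum ℝ M ↔ 0 < M.charpoly.rootMultiplicity μ := by
  rw [Matrix.mem_spectrum_iff_isRoot_charpoly,
    Polynomial.rootMultiplicity_pos (Matrix.charpoly_monic M).ne_zero]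

theorem cycleRho_zero (α : ℝ) (r : ℕ) : cycleRho α r 0 = 2 := by
  simp [cycleRho]
  ring

theorem abs_cycleRho_le {α : ℝ} (hα0 : 0 ≤ α) (hα1 : α ≤ 1) (r i : ℕ) :
    |cycleRho α r i| ≤ 2 := by
  have h1 := Real.neg_one_le_cos (2 * Real.pi * i / r)
  have h2 := Real.cos_le_one (2 * Real.pi * i / r)
  rw [abs_le, cycleRho]
  constructor <;> nlinarith

namespace IsGeneralizedBetheTree

variable {V : Type*} [Fintype V] [DecidableEq V] {B : SimpleGraph V} [DecidableRel B.Adj]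
  {root : V} {k r : ℕ}

theorem rootMultiplicity_charpoly_rootedCopies (hB : IsGeneralizedBetheTree B root k)
    (hr : 3 ≤ r) (α μ : ℝ) :
    ((alphaMatrix α (rootedCopies (SimpleGraph.cycleGraph r) B root)).charpoly.rootMultiplicity μ
        : ℤ) =
      (∑ j ∈ Finset.Icc 1 (k - 1),
        (r : ℤ) * ((levelCount B root k j : ℤ) - (levelCount B root k (j + 1) : ℤ)) *
        ((matT α (levelDegree B root k) k j).charpoly.rootMultiplicity μ : ℤ)) +
      ∑ i : Fin r,
        ((matS α (levelDegree B root k) k (cycleRho α r i)).charpoly.rootMultiplicity μ : ℤ) := by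
  rw [charpoly_rootedCopies_cycleGraph B root α hr, ← Polynomial.count_roots,
    Polynomial.roots_prod _ _ (Finset.prod_ne_zero_iff.2 fun i _ =>
      (Matrix.charpoly_monic _).ne_zero), Multiset.count_bind]
  simp only [Polynomial.count_roots]
  change ((∑ i : Fin r, _ : ℕ) : ℤ) = _
  push_cast
  simp only [hB.rootMultiplicity_charpoly, Finset.sum_add_distrib, Finset.sum_const,
    Finset.card_univ, Fintype.card_fin, nsmul_eq_mul, Finset.mul_sum, mul_assoc]

theorem spectrum_rootedCopies (hB : IsGeneralizedBetheTree B root k) (hr : 3 ≤ r) (α : ℝ) :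
    spectrum ℝ (alphaMatrix α (rootedCopies (SimpleGraph.cycleGraph r) B root)) =
      (⋃ j ∈ {j : ℕ | 1 ≤ j ∧ j ≤ k - 1 ∧
          levelCount B root k (j + 1) < levelCount B root k j},
        spectrum ℝ (matT α (levelDegree B root k) k j)) ∪
        ⋃ i : Fin r, spectrum ℝ (matS α (levelDegree B root k) k (cycleRho α r i)) := by
  ext μ
  have hnn : ∀ j ∈ Finset.Icc 1 (k - 1),
      0 ≤ (r : ℤ) * ((levelCount B root k j : ℤ) - (levelCount B root k (j + 1) : ℤ)) *
        ((matT α (levelDegree B root k) k j).charpoly.rootMultiplicity μ : ℤ) := by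
    intro j hj
    rw [Finset.mem_Icc] at hj
    have h1 := hB.levelCount_succ_le hj.1 hj.2
    have h2 : (0 : ℤ) ≤ (levelCount B root k j : ℤ) - (levelCount B root k (j + 1) : ℤ) := by
      omega
    positivity
  have hr0 : (0 : ℤ) < r := by omega
  rw [Matrix.mem_spectrum_iff_rootMultiplicity_charpoly_pos, ← Nat.cast_pos (α := ℤ),
    hB.rootMultiplicity_charpoly_rootedCopies hr]
  simp only [Set.mem_union, Set.mem_iUnion, Set.mem_ofPred_eq, exists_prop,
    Matrix.mem_spectrum_iff_rootMultiplicity_charpoly_pos]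
  constructor
  · intro h
    by_contra! hcon
    obtain ⟨hT, hS⟩ := hcon
    refine h.ne' ?_
    rw [Finset.sum_eq_zero, Finset.sum_eq_zero, add_zero]
    · intro i _
      exact_mod_cast Nat.le_zero.1 (hS i)
    · intro j hj
      have h0 := Finset.mem_Icc.1 hj
      rcases (hB.levelCount_succ_le h0.1 h0.2).lt_or_eq with h1 | h1
      · rw [Nat.le_zero.1 (hT j ⟨h0.1, h0.2, h1⟩)]
        simp
      · rw [h1]
        simp
  · rintro (⟨j, ⟨h1, h2, h3⟩, h4⟩ | ⟨i, hi⟩)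
    · apply add_pos_of_pos_of_nonneg
      · refine Finset.sum_pos' hnn ⟨j, Finset.mem_Icc.2 ⟨h1, h2⟩, ?_⟩
        have h5 : (0 : ℤ) < (levelCount B root k j : ℤ) - (levelCount B root k (j + 1) : ℤ) := by
          omega
        positivity
      · exact Finset.sum_nonneg fun i _ => Nat.cast_nonneg _
    · apply add_pos_of_nonneg_of_pos
      · exact Finset.sum_nonneg hnn
      · exact Finset.sum_pos' (fun i _ => Nat.cast_nonneg _)
          ⟨i, Finset.mem_univ _, by exact_mod_cast hi⟩

theorem exists_isGreatest_spectralRadius (hB : IsGeneralizedBetheTree B root k) (hr : 3 ≤ r)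
    {α : ℝ} (hα0 : 0 ≤ α) (hα1 : α ≤ 1) :
    ∃ ρ : ℝ, 0 ≤ ρ ∧ IsGreatest (spectrum ℝ (matS α (levelDegree B root k) k 2)) ρ ∧
      spectralRadius ℝ (alphaMatrix α (rootedCopies (SimpleGraph.cycleGraph r) B root)) =
        ENNReal.ofReal ρ := by
  set d := levelDegree B root k
  have hd0 : ∀ j, 0 ≤ α * d j := fun j => mul_nonneg hα0 (Nat.cast_nonneg _)
  obtain ⟨ρ, h1, h2, h3⟩ := jacobiPoly_exists_greatest_root (a := betheDiag α d k 2) hB.one_le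
    (fun j hj hjk => hB.betheSq_nonneg α hj hjk)
  have hρ0 : 0 ≤ ρ := by
    refine le_trans ?_ h1
    have := hd0 1
    rw [betheDiag]
    split_ifs <;> linarith
  have hmem : ρ ∈ spectrum ℝ (matS α d k 2) := by
    rw [Matrix.mem_spectrum_iff_isRoot_charpoly, hB.charpoly_matS]
    exact h2
  -- Ranging over all `j ≤ k` covers `S_i` at `j = k` and the `T_j` below. The diagonal of `S_1`
  -- dominates since |α d_l + ρ_i| ≤ α d_l + 2 at `l = k`.
  have hnot : ∀ μ, ρ < |μ| → ∀ i : Fin r, ∀ j ≤ k,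
      (jacobiPoly (betheDiag α d k (cycleRho α r i)) (betheSq α d k) j).eval μ ≠ 0 := by
    intro μ hμ i j hjk
    refine jacobiPoly_eval_ne_zero_of_abs_le (a := betheDiag α d k 2) (x := |μ|)
      (fun l hl hlj => hB.betheSq_nonneg α hl (hlj.trans hjk)) (fun l _ _ => ?_) le_rfl
      (fun l hl => h3 _ hμ l (hl.trans hjk))
    have h4 := abs_cycleRho_le hα0 hα1 r i
    have h5 := hd0 l
    rw [betheDiag, betheDiag]
    refine (abs_add_le _ _).trans ?_
    rw [abs_of_nonneg h5]
    split_ifs <;> simp [h4]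
  refine ⟨ρ, hρ0, ⟨hmem, ?_⟩, ?_⟩
  · intro μ hμ
    rw [Matrix.mem_spectrum_iff_isRoot_charpoly, hB.charpoly_matS] at hμ
    by_contra! hlt
    exact (h3 μ hlt k le_rfl).ne' hμ
  · have hspec := hB.spectrum_rootedCopies hr α
    apply le_antisymm
    · refine iSup₂_le fun μ hμ => ?_
      have hle : |μ| ≤ ρ := by
        by_contra! hlt
        rw [hspec] at hμ
        simp only [Set.mem_union, Set.mem_iUnion, Set.mem_ofPred_eq, exists_prop,
          Matrix.mem_spectrum_iff_isRoot_charpoly] at hμ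
        obtain ⟨j, ⟨hj1, hj2, -⟩, hj⟩ | ⟨i, hi⟩ := hμ
        -- The index 0 is an arbitrary choice.
        · rw [hB.charpoly_matT α (cycleRho α r (⟨0, by omega⟩ : Fin r)) (by omega)] at hj
          exact hnot μ hlt _ j (by omega) hj
        · rw [hB.charpoly_matS] at hi
          exact hnot μ hlt i k le_rfl hi
      rw [← enorm_eq_nnnorm, ← ofReal_norm, Real.norm_eq_abs]
      exact ENNReal.ofReal_le_ofReal hle
    · have hmem' : ρ ∈ spectrum ℝ
          (alphaMatrix α (rootedCopies (SimpleGraph.cycleGraph r) B root)) := by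
        rw [hspec]
        refine Or.inr (Set.mem_iUnion.2 ⟨⟨0, by omega⟩, ?_⟩)
        rw [cycleRho_zero]
        exact hmem
      refine le_trans ?_ (le_iSup₂ (f := fun (μ : ℝ) _ => (‖μ‖₊ : ENNReal)) ρ hmem')
      rw [← enorm_eq_nnnorm, ← ofReal_norm, Real.norm_eq_abs, abs_of_nonneg hρ0]

end IsGeneralizedBetheTree

theorem mainTheorem4 {V : Type*} [Fintype V] [DecidableEq V] (B : SimpleGraph V)
    [DecidableRel B.Adj] (root : V) (k : ℕ) (hB : IsGeneralizedBetheTree B root k)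
    (r : ℕ) (hr : 3 ≤ r) (α : ℝ) (hα0 : 0 ≤ α) (hα1 : α ≤ 1)
    (n d : ℕ → ℕ) (hn : n = levelCount B root k) (hd : d = levelDegree B root k)
    (A : Matrix (Fin r × V) (Fin r × V) ℝ)
    (hA : A = alphaMatrix α (rootedCopies (SimpleGraph.cycleGraph r) B root)) :
    -- (1) the spectrum; the matrices `T_j` with `n_j = n_{j+1}` have multiplicity `0`
    (spectrum ℝ A =
      (⋃ j ∈ {j : ℕ | 1 ≤ j ∧ j ≤ k - 1 ∧ n (j + 1) < n j}, spectrum ℝ (matT α d k j)) ∪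
        ⋃ i : Fin r, spectrum ℝ (matS α d k (cycleRho α r i))) ∧
    -- (2) the multiplicities, added together over the different matrices
    (∀ μ : ℝ, (A.charpoly.rootMultiplicity μ : ℤ) =
      (∑ j ∈ Finset.Icc 1 (k - 1), (r : ℤ) * ((n j : ℤ) - (n (j + 1) : ℤ)) *
        ((matT α d k j).charpoly.rootMultiplicity μ : ℤ)) +
      ∑ i : Fin r, ((matS α d k (cycleRho α r i)).charpoly.rootMultiplicity μ : ℤ)) ∧
    -- (2) for `α < 1`, the eigenvalues of each single matrix are simple
    (α < 1 →
      (∀ j ∈ Finset.Icc 1 (k - 1), ∀ μ ∈ spectrum ℝ (matT α d k j),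
        (matT α d k j).charpoly.rootMultiplicity μ = 1) ∧
      ∀ i : Fin r, ∀ μ ∈ spectrum ℝ (matS α d k (cycleRho α r i)),
        (matS α d k (cycleRho α r i)).charpoly.rootMultiplicity μ = 1) ∧
    -- (3) the matrix `S_1`, and the spectral radius
    cycleRho α r 0 = 2 ∧
    ∃ ρ : ℝ, 0 ≤ ρ ∧ IsGreatest (spectrum ℝ (matS α d k 2)) ρ ∧
      spectralRadius ℝ A = ENNReal.ofReal ρ := by
  subst hn hd hA
  refine ⟨hB.spectrum_rootedCopies hr α, hB.rootMultiplicity_charpoly_rootedCopies hr α,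
    fun hα => ⟨fun j hj μ hμ => ?_, fun i μ hμ => ?_⟩, cycleRho_zero α r,
    hB.exists_isGreatest_spectralRadius hr hα0 hα1⟩
  · have hjk : j < k := by
      have := hB.one_le
      rw [Finset.mem_Icc] at hj
      omega
    rw [Matrix.mem_spectrum_iff_isRoot_charpoly, hB.charpoly_matT α 0 hjk] at hμ
    rw [hB.charpoly_matT α 0 hjk]
    exact jacobiPoly_rootMultiplicity_eq_one
      (fun i hi hij => hB.betheSq_pos hα hi (hij.trans hjk.le)) hμ
  · rw [Matrix.mem_spectrum_iff_isRoot_charpoly, hB.charpoly_matS] at hμ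
    rw [hB.charpoly_matS]
    exact jacobiPoly_rootMultiplicity_eq_one (fun i hi hik => hB.betheSq_pos hα hi hik) hμ
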